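/- All graphs are finite and simple. A mixed graph $\widetilde G$ is obtained from a graph $G$ (its underlying graph) by assigning directions to some of the edges of $G$. Its Hermitian adjacency matrix $H(\widetilde G)=(h_{uv})$ has $h_{uv}=1$ if $uv$ is an undirected edge, $h_{uv}=i$ if there is an arc from $u$ to $v$, $h_{uv}=-i$ if there is an arc from $v$ to $u$, and $h_{uv}=0$ otherwise; $\widetilde G$ is nonsingular if $\det H(\widetilde G)\neq 0$. For a cycle $C$ of $G$, the signature $\sigma(\widetilde C)$ is $|f-b|$, where, for a chosen direction of traversal of $C$, $f$ and $b$ are the numbers of edges of $C$ that are directed forward and backward, respectively (undirected edges are not counted). A fractional matching of $G$ is a function $f:E(G)\to[0,1]$ such that, for every vertex $v$, the values of $f$ on the edges incident to $v$ add up to at most $1$. The maximum of $\sum_{e\in E(G)}f(e)$ over all fractional matchings is denoted $m^*(G)$. A fractional perfect matching is a fractional matching with $\sum_{e\in E(G)}f(e)=|V(G)|/2$. Let $\mathcal F$ be the set of fractional matchings $f$ of $G$ with $\sum_{e\in E(G)}f(e)=m^*(G)$ and $f(e)\in\{0,\tfrac12,1\}$ for every edge $e$. An optimal fractional matching is an $f\in\mathcal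 F$ for which the number of edges $e$ with $f(e)=1$ is the largest possible within $\mathcal F$. **Theorem 1.5.** Let $\widetilde G$ be a mixed graph whose underlying graph $G$ is bipartite and in which any two distinct cycles are vertex-disjoint. Then $\widetilde G$ is nonsingular if and only if the following two conditions both hold: (a) $G$ has a fractional perfect matching; (b) there exists an optimal fractional matching $f$ of $G$ such that, for every even cycle $C_q$ of $G$ (of length $q$) with $\sigma(\widetilde C_q)\equiv q \pmod 4$, there is an edge $e$ of $G$ with one endpoint in $V(C_q)$ and the other outside $V(C_q)$ such that $f(e)=1$. -/

import Mathlib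

namespace SimpleGraph

variable {V : Type*}

/-- The distinct cycles of `G` (as subgraphs) are pairwise vertex-disjoint. -/
def CyclesVertexDisjoint (G : SimpleGraph V) : Prop :=
  ∀ ⦃u v : V⦄ (c : G.Walk u u) (d : G.Walk v v), c.IsCycle → d.IsCycle →
    c.toSubgraph ≠ d.toSubgraph → ∀ x : V, x ∈ c.support → x ∉ d.support

/-- The edges of `G` with one endpoint in `S` and the other endpoint outside `S`. -/
def edgesLeaving (G : SimpleGraph V) (S : Set V) : Set G.edgeSet :=
  {e | (∃ x ∈ (e : Sym2 V), x ∈ S) ∧ ∃ y ∈ (e : Sym2 V), y ∉ S}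

variable [Fintype V]

open Classical in
/-- The total weight of a weighting of the edges. -/
noncomputable def totalWeight (G : SimpleGraph V) (f : G.edgeSet → ℝ) : ℝ :=
  ∑ e : G.edgeSet, f e

open Classical in
/-- The sum of the weights of the edges incident to `v`. -/
noncomputable def weightAt (G : SimpleGraph V) (f : G.edgeSet → ℝ) (v : V) : ℝ :=
  ∑ e ∈ Finset.univ.filter (fun e : G.edgeSet => v ∈ (e : Sym2 V)), f e

/-- A fractional matching: edge weights in `[0, 1]` with sum at most `1` around each vertex. -/
def IsFractionalMatching (G : SimpleGraph V) (f : G.edgeSet → ℝ) : Prop :=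
  (∀ e, f e ∈ Set.Icc (0 : ℝ) 1) ∧ ∀ v, G.weightAt f v ≤ 1

/-- The fractional matching number. The set is nonempty, bounded and compact, so this supremum
is a maximum. -/
noncomputable def fractionalMatchingNumber (G : SimpleGraph V) : ℝ :=
  sSup {t | ∃ f : G.edgeSet → ℝ, G.IsFractionalMatching f ∧ t = G.totalWeight f}

/-- A fractional perfect matching: a fractional matching of total weight `|V| / 2`. -/
def IsFractionalPerfectMatching (G : SimpleGraph V) (f : G.edgeSet → ℝ) : Prop :=
  G.IsFractionalMatching f ∧ G.totalWeight f = (Fintype.card V : ℝ) / 2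

/-- The fractional matchings of maximum total weight with all weights in `{0, 1/2, 1}`. -/
def maxHalfIntegralMatchings (G : SimpleGraph V) : Set (G.edgeSet → ℝ) :=
  {f | G.IsFractionalMatching f ∧ G.totalWeight f = G.fractionalMatchingNumber ∧
    ∀ e, f e = 0 ∨ f e = 1 / 2 ∨ f e = 1}

/-- An optimal fractional matching: a maximum fractional matching with weights in `{0, 1/2, 1}`
having, among all of these, the largest number of edges of weight `1`. -/
def IsOptimalFractionalMatching (G : SimpleGraph V) (f : G.edgeSet → ℝ) : Prop :=
  f ∈ G.maxHalfIntegralMatchings ∧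
    ∀ g ∈ G.maxHalfIntegralMatchings, {e | g e = 1}.ncard ≤ {e | f e = 1}.ncard

end SimpleGraph

/-- A mixed graph: a simple graph some of whose edges have been given a direction.
`Arc u v` says that the edge `uv` is directed from `u` to `v`. -/
structure MixedGraph (V : Type*) where
  graph : SimpleGraph V
  Arc : V → V → Prop
  adj_of_arc : ∀ u v, Arc u v → graph.Adj u v
  not_arc_of_arc : ∀ u v, Arc u v → ¬ Arc v u

namespace MixedGraph

variable {V : Type*}

open Classical in
/-- The Hermitian adjacency matrix. -/
noncomputable def hermitianAdjMatrix (M : MixedGraph V) : Matrix V V ℂ :=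
  Matrix.of fun u v =>
    if M.Arc u v then Complex.I
    else if M.Arc v u then -Complex.I
    else if M.graph.Adj u v then 1
    else 0

/-- A mixed graph is nonsingular when its Hermitian adjacency matrix is. -/
def Nonsingular [Fintype V] [DecidableEq V] (M : MixedGraph V) : Prop :=
  M.hermitianAdjMatrix.det ≠ 0

open Classical in
/-- The signature `|f - b|` of a closed walk tracing a cycle: `f` edges are directed along the
walk and `b` edges against it. Another starting point or the reverse traversal of the same cycle
gives the same value. -/
noncomputable def signature (M : MixedGraph V) {u : V} (c : M.graph.Walk u u) : ℕ :=
  ((c.darts.countP fun d => M.Arc d.fst d.snd : ℤ) -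
    (c.darts.countP fun d => M.Arc d.snd d.fst : ℤ)).natAbs

end MixedGraph

/-! Let `H` be the Hermitian adjacency matrix. If `det H ≠ 0`, or if there is a fractional perfect
matching, then some permutation moves every vertex along an edge, so the bipartite graph has a
perfect matching `μ`; the optimal fractional matchings are then exactly the perfect matchings.

Fix `μ` and let `A v w = H v (μ w) * H (μ w) w`. Up to a unit `det A` is `det H`, and `A` has unit
diagonal. A permutation `σ` contributes to the Leibniz expansion of `det A` only if `v` is adjacent
to `μ (σ v)` for all `v`, and then its nontrivial orbits trace `μ`-alternating cycles. If cycles are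
edge-disjoint, two such cycles through `v` coincide because they share the edge joining `v` to
`μ v`; hence all these `σ` are subordinate to a single permutation `ρ`, in the sense that `σ v = v`
or `σ v = ρ v`. So `det A` only depends on the entries `a v = A v (ρ v)` with `ρ v ≠ v`, and
`x + a • (x ∘ ρ) = 0` has a nonzero solution exactly when the product of `-a` over some orbit is
`1`. For an orbit that traces a cycle of length `q` this says that the entries of `H` along the
cycle multiply to `i ^ q`, which means that the signature is congruent to `q` modulo `4`. -/

section SubordinatePermutations

open Function Matrix

variable {n R : Type*}

theorem exists_perm_of_agree_on_moved [Finite n] {S : Set (Equiv.Perm n)}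
    (hS : ∀ σ ∈ S, ∀ τ ∈ S, ∀ v, σ v ≠ v → τ v ≠ v → σ v = τ v) :
    ∃ ρ : Equiv.Perm n, (∀ σ ∈ S, ∀ v, σ v = v ∨ σ v = ρ v) ∧
      ∀ v, ρ v = v ∨ ∃ σ ∈ S, ρ v = σ v := by
  have hs (v : n) : ∃ w, (∀ σ ∈ S, σ v = v ∨ σ v = w) ∧ (w = v ∨ ∃ σ ∈ S, w = σ v) := by
    by_cases h : ∃ σ ∈ S, σ v ≠ v
    · obtain ⟨σ, hσ, hσv⟩ := h
      exact ⟨σ v, fun τ hτ ↦ or_iff_not_imp_left.mpr fun hτv ↦ hS τ hτ σ hσ v hτv hσv,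
        .inr ⟨σ, hσ, rfl⟩⟩
    · push Not at h
      exact ⟨v, fun σ hσ ↦ .inl (h σ hσ), .inl rfl⟩
  choose s hs_sub hs_mem using hs
  have surj : Surjective s := by
    intro v
    obtain hv | ⟨σ, hσ, hσv⟩ := hs_mem v
    · exact ⟨v, hv⟩
    · obtain hv | hv := hs_sub (σ.symm v) σ hσ
      · rw [σ.apply_symm_apply] at hv
        exact ⟨v, hσv.trans (σ.eq_symm_apply.mp hv)⟩
      · exact ⟨σ.symm v, by rw [← hv, σ.apply_symm_apply]⟩
  exact ⟨.ofBijective s (Finite.injective_iff_surjective.mpr surj |>.bijective_of_finite),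
    fun σ hσ v ↦ hs_sub v σ hσ, hs_mem⟩

theorem iterate_mul_comp_apply [CommMonoid R] (b : n → R) (ρ : n → n) (x : n → R) (k : ℕ) (v : n) :
    (fun x v ↦ b v * x (ρ v))^[k] x v = (∏ i ∈ Finset.range k, b (ρ^[i] v)) * x (ρ^[k] v) := by
  induction k generalizing v with
  | zero => simp
  | succ k ih =>
    rw [iterate_succ_apply', ih, Finset.prod_range_succ', iterate_succ_apply]
    simp only [iterate_succ_apply, iterate_zero_apply]
    ac_rfl

theorem isFixedPt_sum_range_iterate {M : Type*} [AddCommGroup M] (F : M →+ M) {k : ℕ} {x : M}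
    (hx : IsPeriodicPt F k x) : IsFixedPt F (∑ i ∈ Finset.range k, F^[i] x) := by
  rw [IsFixedPt, map_sum]
  apply add_right_cancel (b := F^[0] x)
  simp only [← iterate_succ_apply' F]
  rw [← Finset.sum_range_succ' (fun i ↦ F^[i] x), Finset.sum_range_succ, hx.eq, iterate_zero_apply]

variable [CommRing R] [IsDomain R]

theorem exists_isFixedPt_mul_comp_iff [Finite n] (b : n → R) (ρ : Equiv.Perm n) :
    (∃ x ≠ 0, IsFixedPt (fun (x : n → R) v ↦ b v * x (ρ v)) x) ↔
      ∃ v, ∏ i ∈ Finset.range (minimalPeriod ρ v), b (ρ^[i] v) = 1 := by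
  classical
  set F : (n → R) → n → R := fun x v ↦ b v * x (ρ v)
  constructor
  · rintro ⟨x, hx, hFx⟩
    obtain ⟨v, hv⟩ := Function.ne_iff.mp hx
    have h := congrFun (hFx.iterate (minimalPeriod ρ v)) v
    rw [iterate_mul_comp_apply, iterate_minimalPeriod] at h
    exact ⟨v, mul_right_cancel₀ hv (by rw [h, one_mul])⟩
  · rintro ⟨v, hv⟩
    have hpos : 0 < minimalPeriod ρ v :=
      minimalPeriod_pos_of_mem_periodicPts (ρ.injective.mem_periodicPts v)
    set e : n → R := Pi.single v 1 with he
    have cyclic : IsPeriodicPt F (minimalPeriod ρ v) e := by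
      ext w
      rw [iterate_mul_comp_apply]
      obtain rfl | hw := eq_or_ne w v
      · rw [hv, iterate_minimalPeriod, one_mul]
      · have : ρ^[minimalPeriod ρ v] w ≠ v := fun h ↦
          hw (ρ.injective.iterate _ (h.trans iterate_minimalPeriod.symm))
        rw [he, Pi.single_eq_of_ne this, Pi.single_eq_of_ne hw, mul_zero]
    have coord_v : ∀ k ∈ Finset.range (minimalPeriod ρ v), k ≠ 0 → F^[k] e v = 0 := by
      intro k hk hk0
      have : ρ^[k] v ≠ v :=
        not_isPeriodicPt_of_pos_of_lt_minimalPeriod hk0 (Finset.mem_range.mp hk)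
      rw [iterate_mul_comp_apply, he, Pi.single_eq_of_ne this, mul_zero]
    refine ⟨∑ k ∈ Finset.range (minimalPeriod ρ v), F^[k] e, fun h ↦ ?_,
      isFixedPt_sum_range_iterate (.mk' F fun x y ↦ funext fun v ↦ mul_add _ _ _) cyclic⟩
    have h1 := congrFun h v
    rw [Finset.sum_apply, Finset.sum_eq_single_of_mem 0 (Finset.mem_range.mpr hpos) coord_v,
      iterate_zero_apply, he, Pi.single_eq_same, Pi.zero_apply] at h1
    exact one_ne_zero h1

variable [Fintype n] [DecidableEq n]

theorem det_eq_zero_iff_of_apply_eq_zero {A : Matrix n n R} {ρ : Equiv.Perm n}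
    (hdiag : ∀ v, A v v = 1) (hA : ∀ v w, w ≠ v → w ≠ ρ v → A v w = 0) :
    A.det = 0 ↔ ∃ v, ρ v ≠ v ∧
      ∏ i ∈ Finset.range (minimalPeriod ρ v), -A (ρ^[i] v) (ρ^[i + 1] v) = 1 := by
  let b v := if ρ v = v then 0 else -A v (ρ v)
  have b_fixed {v} (hv : ρ v = v) : b v = 0 := if_pos hv
  have b_moved {v} (hv : ρ v ≠ v) : b v = -A v (ρ v) := if_neg hv
  have mulVec_apply (x : n → R) (v : n) : (A *ᵥ x) v = x v - b v * x (ρ v) := by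
    obtain hv | hv := eq_or_ne (ρ v) v
    · rw [b_fixed hv, zero_mul, sub_zero, mulVec, dotProduct,
        Finset.sum_eq_single v (fun w _ hw ↦ by rw [hA v w hw (hv.symm ▸ hw), zero_mul]) (by simp),
        hdiag, one_mul]
    · rw [b_moved hv, mulVec, dotProduct, Fintype.sum_eq_add v (ρ v) hv.symm
        fun w hw ↦ by rw [hA v w hw.1 hw.2, zero_mul], hdiag]
      ring
  have kernel_iff (x : n → R) : A *ᵥ x = 0 ↔ IsFixedPt (fun (x : n → R) v ↦ b v * x (ρ v)) x := by
    simp only [IsFixedPt, funext_iff, mulVec_apply, Pi.zero_apply, sub_eq_zero,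
      eq_comm (a := x _)]
  rw [← exists_mulVec_eq_zero_iff]
  simp only [kernel_iff, exists_isFixedPt_mul_comp_iff]
  refine exists_congr fun v ↦ ?_
  obtain hv | hv := eq_or_ne (ρ v) v
  · have : minimalPeriod ρ v = 1 := minimalPeriod_eq_one_iff_isFixedPt.mpr hv
    simp [this, b_fixed hv, hv]
  · simp only [ne_eq, hv, not_false_eq_true, true_and]
    have moved (i : ℕ) : ρ (ρ^[i] v) ≠ ρ^[i] v := fun h ↦
      hv (ρ.injective.iterate i (by rwa [← iterate_succ_apply, iterate_succ_apply']))
    simp only [b_moved (moved _), iterate_succ_apply']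

theorem det_eq_zero_iff_of_subordinate {A : Matrix n n R} {ρ : Equiv.Perm n}
    (hdiag : ∀ v, A v v = 1)
    (hρ : ∀ σ : Equiv.Perm n, (∀ v, A v (σ v) ≠ 0) → ∀ v, σ v = v ∨ σ v = ρ v) :
    A.det = 0 ↔ ∃ v, ρ v ≠ v ∧
      ∏ i ∈ Finset.range (minimalPeriod ρ v), -A (ρ^[i] v) (ρ^[i + 1] v) = 1 := by
  let B : Matrix n n R := of fun v w ↦ if w = v ∨ w = ρ v then A v w else 0
  have hAB {v w : n} (h : w = v ∨ w = ρ v) : B v w = A v w := if_pos h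
  have prod_eq (σ : Equiv.Perm n) : ∏ v, A v (σ v) = ∏ v, B v (σ v) := by
    by_cases hσ : ∀ v, σ v = v ∨ σ v = ρ v
    · exact Finset.prod_congr rfl fun v _ ↦ (hAB (hσ v)).symm
    · obtain ⟨v, hv⟩ := not_forall.mp (mt (hρ σ) hσ)
      obtain ⟨w, hw⟩ := not_forall.mp hσ
      rw [Finset.prod_eq_zero (Finset.mem_univ v) (not_not.mp hv),
        Finset.prod_eq_zero (Finset.mem_univ w) (if_neg hw)]
  have det_eq : A.det = B.det := by
    rw [← det_transpose A, ← det_transpose B, det_apply, det_apply]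
    simp only [transpose_apply, prod_eq]
  rw [det_eq, det_eq_zero_iff_of_apply_eq_zero (fun v ↦ (hAB (.inl rfl)).trans (hdiag v))
    fun v w hwv hwρ ↦ if_neg (not_or_intro hwv hwρ)]
  simp only [iterate_succ_apply', hAB (.inr rfl)]

end SubordinatePermutations
section EdgeWeights

open SimpleGraph

variable {V : Type*} {G : SimpleGraph V}

open Classical in
/-- The symmetric matrix of an edge weighting, with entry `f(vw)` at `(v, w)` and `0` at
non-adjacent pairs. -/
noncomputable def weightMatrix (f : G.edgeSet → ℝ) : Matrix V V ℝ :=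
  .of fun v w ↦ if h : G.Adj v w then f ⟨s(v, w), h⟩ else 0

theorem weightMatrix_apply_of_adj (f : G.edgeSet → ℝ) {v w : V} (h : G.Adj v w) :
    weightMatrix f v w = f ⟨s(v, w), h⟩ :=
  dif_pos h

theorem adj_of_weightMatrix_ne_zero {f : G.edgeSet → ℝ} {v w : V} (h : weightMatrix f v w ≠ 0) :
    G.Adj v w :=
  of_not_not (mt (dif_neg ·) h)

theorem weightMatrix_comm (f : G.edgeSet → ℝ) (v w : V) :
    weightMatrix f v w = weightMatrix f w v := by
  by_cases h : G.Adj v w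
  · simp only [weightMatrix_apply_of_adj, h, h.symm, Sym2.eq_swap]
  · simp only [weightMatrix, Matrix.of_apply, h, mt Adj.symm h, dite_false]

theorem weightMatrix_nonneg {f : G.edgeSet → ℝ} (hf : ∀ e, 0 ≤ f e) (v w : V) :
    0 ≤ weightMatrix f v w := by
  rw [weightMatrix, Matrix.of_apply]
  split_ifs
  exacts [hf _, le_rfl]

variable [Fintype V]

theorem sum_weightMatrix_apply (f : G.edgeSet → ℝ) (v : V) :
    ∑ w, weightMatrix f v w = G.weightAt f v := by
  classical
  rw [← Finset.sum_filter_of_ne fun w _ ↦ adj_of_weightMatrix_ne_zero]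
  refine Finset.sum_bij (fun w hw ↦ ⟨s(v, w), (Finset.mem_filter.mp hw).2⟩) ?_ ?_ ?_ ?_
  · exact fun w _ ↦ Finset.mem_filter.mpr ⟨Finset.mem_univ _, Sym2.mem_mk_left v w⟩
  · exact fun w _ w' _ h ↦ Sym2.congr_right.mp (congrArg Subtype.val h)
  · rintro ⟨_, he⟩ hv
    obtain ⟨w, rfl⟩ := (Finset.mem_filter.mp hv).2
    exact ⟨w, Finset.mem_filter.mpr ⟨Finset.mem_univ w, he⟩, rfl⟩
  · exact fun w hw ↦ weightMatrix_apply_of_adj f (Finset.mem_filter.mp hw).2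

theorem sum_weightAt (f : G.edgeSet → ℝ) : ∑ v, G.weightAt f v = 2 * G.totalWeight f := by
  classical
  simp only [weightAt, totalWeight, Finset.sum_filter]
  rw [Finset.sum_comm, Finset.mul_sum]
  refine Finset.sum_congr rfl fun ⟨e, he⟩ _ ↦ ?_
  induction e using Sym2.ind with
  | _ x y =>
    have endpoints : Finset.univ.filter (· ∈ s(x, y)) = {x, y} := by ext; simp
    rw [← Finset.sum_filter, endpoints, Finset.sum_pair (G.ne_of_adj he), two_mul]

theorem totalWeight_le_half_card {f : G.edgeSet → ℝ} (hf : G.IsFractionalMatching f) :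
    G.totalWeight f ≤ (Fintype.card V : ℝ) / 2 := by
  have h := Finset.sum_le_card_nsmul Finset.univ _ 1 fun v _ ↦ hf.2 v
  rw [sum_weightAt, Finset.card_univ, nsmul_one] at h
  linarith

theorem isFractionalPerfectMatching_iff {f : G.edgeSet → ℝ} :
    G.IsFractionalPerfectMatching f ↔ (∀ e, 0 ≤ f e) ∧ ∀ v, G.weightAt f v = 1 := by
  classical
  have handshake := sum_weightAt f
  constructor
  · intro hf
    refine ⟨fun e ↦ (hf.1.1 e).1, fun v ↦ ?_⟩
    have total : ∑ v, G.weightAt f v = ∑ _v : V, (1 : ℝ) := by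
      rw [handshake, hf.2, Finset.sum_const, Finset.card_univ, nsmul_one]
      ring
    exact (Finset.sum_eq_sum_iff_of_le fun v _ ↦ hf.1.2 v).mp total v (Finset.mem_univ v)
  · rintro ⟨hnonneg, hone⟩
    refine ⟨⟨fun e ↦ ⟨hnonneg e, ?_⟩, fun v ↦ (hone v).le⟩, ?_⟩
    · obtain ⟨v, hv⟩ : ∃ v, v ∈ (e : Sym2 V) := ⟨_, Sym2.out_fst_mem _⟩
      rw [← hone v]
      exact Finset.single_le_sum (fun e _ ↦ hnonneg e)
        (Finset.mem_filter.mpr ⟨Finset.mem_univ e, hv⟩)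
    · simp only [hone, Finset.sum_const, Finset.card_univ, nsmul_one] at handshake
      linarith

theorem fractionalMatchingNumber_eq_half_card {f : G.edgeSet → ℝ}
    (hf : G.IsFractionalPerfectMatching f) :
    G.fractionalMatchingNumber = (Fintype.card V : ℝ) / 2 := by
  refine IsGreatest.csSup_eq ⟨⟨f, hf.1, hf.2.symm⟩, ?_⟩
  rintro _ ⟨g, hg, rfl⟩
  exact totalWeight_le_half_card hg

theorem weightMatrix_mem_doublyStochastic [DecidableEq V] {f : G.edgeSet → ℝ}
    (hf : G.IsFractionalPerfectMatching f) : weightMatrix f ∈ doublyStochastic ℝ V := by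
  obtain ⟨hnonneg, hone⟩ := isFractionalPerfectMatching_iff.mp hf
  rw [mem_doublyStochastic_iff_sum]
  refine ⟨weightMatrix_nonneg hnonneg, fun v ↦ by rw [sum_weightMatrix_apply, hone], fun w ↦ ?_⟩
  simp only [weightMatrix_comm f _ w, sum_weightMatrix_apply, hone]

theorem exists_perm_adj_of_isFractionalPerfectMatching {f : G.edgeSet → ℝ}
    (hf : G.IsFractionalPerfectMatching f) : ∃ π : Equiv.Perm V, ∀ v, G.Adj v (π v) := by
  classical
  obtain ⟨c, hc, hsum, hf'⟩ :=
    exists_eq_sum_perm_of_mem_doublyStochastic (weightMatrix_mem_doublyStochastic hf)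
  obtain ⟨π, -, hπ⟩ := Finset.exists_ne_zero_of_sum_ne_zero (hsum ▸ one_ne_zero)
  refine ⟨π, fun v ↦ adj_of_weightMatrix_ne_zero (f := f) (ne_of_gt ?_)⟩
  calc 0 < c π := (hc π).lt_of_ne' hπ
    _ = (c π • π.permMatrix ℝ) v (π v) := by simp [Equiv.toPEquiv_apply, PEquiv.toMatrix_apply]
    _ ≤ ∑ σ, (c σ • σ.permMatrix ℝ) v (π v) := by
        refine Finset.single_le_sum (f := fun σ : Equiv.Perm V ↦ (c σ • σ.permMatrix ℝ) v (π v))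
          (fun σ _ ↦ ?_) (Finset.mem_univ π)
        exact mul_nonneg (hc σ) (nonneg_of_mem_doublyStochastic permMatrix_mem_doublyStochastic)
    _ = weightMatrix f v (π v) := by rw [← hf', Matrix.sum_apply]

open Classical in
theorem ncard_eq_sum_ite (f : G.edgeSet → ℝ) :
    ({e | f e = 1}.ncard : ℝ) = ∑ e, if f e = 1 then 1 else 0 := by
  rw [Finset.sum_boole, Set.ncard_eq_toFinset_card', Set.toFinset_ofPred]

theorem ite_eq_one_le {x : ℝ} [Decidable (x = 1)] (hx : 0 ≤ x) : (if x = 1 then 1 else 0) ≤ x := by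
  split_ifs with h
  exacts [h.ge, hx]

theorem ncard_le_totalWeight {f : G.edgeSet → ℝ} (hf : ∀ e, 0 ≤ f e) :
    ({e | f e = 1}.ncard : ℝ) ≤ G.totalWeight f := by
  rw [ncard_eq_sum_ite, totalWeight]
  exact Finset.sum_le_sum fun e _ ↦ ite_eq_one_le (hf e)

theorem ncard_eq_totalWeight_iff {f : G.edgeSet → ℝ} (hf : ∀ e, 0 ≤ f e) :
    ({e | f e = 1}.ncard : ℝ) = G.totalWeight f ↔ ∀ e, f e = 0 ∨ f e = 1 := by
  classical
  rw [ncard_eq_sum_ite, totalWeight, Finset.sum_eq_sum_iff_of_le fun e _ ↦ ite_eq_one_le (hf e)]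
  refine ⟨fun h e ↦ ?_, fun h e _ ↦ ?_⟩
  · have := h e (Finset.mem_univ e)
    grind
  · obtain h | h := h e <;> simp [h]

end EdgeWeights

/-- A perfect matching of `G`, encoded as the fixed-point-free involution that sends every vertex
to its partner. -/
structure IsMatchingInvolution {V : Type*} (G : SimpleGraph V) (μ : V → V) : Prop where
  involutive : Function.Involutive μ
  adj (v : V) : G.Adj v (μ v)

section MatchingInvolutions

open SimpleGraph

variable {V : Type*} {G : SimpleGraph V} {μ : V → V}

theorem exists_isMatchingInvolution_of_perm (hG : G.IsBipartite) {π : Equiv.Perm V}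
    (hπ : ∀ v, G.Adj v (π v)) : ∃ μ, IsMatchingInvolution G μ := by
  obtain ⟨C⟩ := hG
  have color_apply {v : V} (hv : C v = 0) : C (π v) ≠ 0 := fun h ↦ C.valid (hπ v) (hv.trans h.symm)
  have color_symm_apply {v : V} (hv : C v ≠ 0) : C (π.symm v) = 0 := by
    have := C.valid (hπ (π.symm v))
    rw [π.apply_symm_apply] at this
    lia
  refine ⟨fun v ↦ if C v = 0 then π v else π.symm v, fun v ↦ ?_, fun v ↦ ?_⟩ <;>
    by_cases hv : C v = 0
  · simp only [hv, if_true, color_apply hv, if_false, π.symm_apply_apply]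
  · simp only [hv, if_false, color_symm_apply hv, if_true, π.apply_symm_apply]
  · simpa only [hv, if_true] using hπ v
  · simpa only [hv, if_false, π.apply_symm_apply] using (hπ (π.symm v)).symm

open Classical in
/-- The indicator function of the edges `{v, μ v}`. -/
noncomputable def matchingWeight (G : SimpleGraph V) (μ : V → V) (e : G.edgeSet) : ℝ :=
  if ∃ v, (e : Sym2 V) = s(v, μ v) then 1 else 0

theorem matchingWeight_eq_one_iff {e : G.edgeSet} :
    matchingWeight G μ e = 1 ↔ ∃ v, (e : Sym2 V) = s(v, μ v) := by
  classical rw [matchingWeight, ite_eq_left_iff, imp_iff_not zero_ne_one, not_not]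

theorem matchingWeight_eq_zero_or_one (e : G.edgeSet) :
    matchingWeight G μ e = 0 ∨ matchingWeight G μ e = 1 := by
  classical exact (ite_eq_or_eq _ _ _).symm

theorem exists_mem_edgesLeaving_matchingWeight_eq_one_iff (hμ : IsMatchingInvolution G μ)
    {S : Set V} : (∃ e ∈ G.edgesLeaving S, matchingWeight G μ e = 1) ↔ ∃ v ∈ S, μ v ∉ S := by
  simp only [matchingWeight_eq_one_iff, edgesLeaving, Set.mem_ofPred_eq]
  constructor
  · rintro ⟨e, ⟨⟨x, hxe, hx⟩, y, hye, hy⟩, v, hv⟩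
    rw [hv, Sym2.mem_iff] at hxe hye
    obtain rfl | rfl := hxe <;> obtain rfl | rfl := hye
    · exact absurd hx hy
    · exact ⟨_, hx, hy⟩
    · exact ⟨_, hx, by rwa [hμ.involutive]⟩
    · exact absurd hx hy
  · rintro ⟨v, hv, hμv⟩
    exact ⟨⟨s(v, μ v), hμ.adj v⟩, ⟨⟨v, Sym2.mem_mk_left _ _, hv⟩, _, Sym2.mem_mk_right _ _, hμv⟩,
      v, rfl⟩

variable [Fintype V]

theorem IsMatchingInvolution.weightAt_matchingWeight (hμ : IsMatchingInvolution G μ) (v : V) :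
    G.weightAt (matchingWeight G μ) v = 1 := by
  classical
  rw [weightAt, Finset.sum_eq_single_of_mem (⟨s(v, μ v), hμ.adj v⟩ : G.edgeSet)
    (Finset.mem_filter.mpr ⟨Finset.mem_univ _, Sym2.mem_mk_left v _⟩)]
  · exact matchingWeight_eq_one_iff.mpr ⟨v, rfl⟩
  · intro e he hne
    refine (matchingWeight_eq_zero_or_one e).resolve_right fun h ↦ hne (Subtype.ext ?_)
    obtain ⟨w, hw⟩ := matchingWeight_eq_one_iff.mp h
    have hv := (Finset.mem_filter.mp he).2
    rw [hw, Sym2.mem_iff] at hv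
    obtain rfl | rfl := hv
    · exact hw
    · simp only [hw, hμ.involutive w, Sym2.eq_swap]

theorem IsMatchingInvolution.isFractionalPerfectMatching (hμ : IsMatchingInvolution G μ) :
    G.IsFractionalPerfectMatching (matchingWeight G μ) := by
  refine isFractionalPerfectMatching_iff.mpr ⟨fun e ↦ ?_, hμ.weightAt_matchingWeight⟩
  obtain h | h := matchingWeight_eq_zero_or_one (μ := μ) e <;> simp [h]

theorem exists_eq_matchingWeight {f : G.edgeSet → ℝ} (hf : G.IsFractionalPerfectMatching f)
    (h01 : ∀ e, f e = 0 ∨ f e = 1) :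
    ∃ ν, IsMatchingInvolution G ν ∧ f = matchingWeight G ν := by
  classical
  obtain ⟨hnonneg, hone⟩ := isFractionalPerfectMatching_iff.mp hf
  have weight_one {v w} (h : weightMatrix f v w ≠ 0) : weightMatrix f v w = 1 := by
    have hvw := adj_of_weightMatrix_ne_zero h
    rw [weightMatrix_apply_of_adj f hvw] at h ⊢
    exact (h01 _).resolve_left h
  have exists_partner (v : V) : ∃ w, weightMatrix f v w = 1 := by
    obtain ⟨w, -, hw⟩ := Finset.exists_ne_zero_of_sum_ne_zero
      (((sum_weightMatrix_apply f v).trans (hone v)).trans_ne one_ne_zero)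
    exact ⟨w, weight_one hw⟩
  have partner_unique {v w w'} (hw : weightMatrix f v w = 1) (hw' : weightMatrix f v w' = 1) :
      w = w' := by
    by_contra hne
    have := Finset.add_le_sum (fun u _ ↦ weightMatrix_nonneg hnonneg v u)
      (Finset.mem_univ w) (Finset.mem_univ w') hne
    rw [hw, hw', sum_weightMatrix_apply, hone] at this
    norm_num at this
  choose ν hν using exists_partner
  have partner_adj (v : V) : G.Adj v (ν v) :=
    adj_of_weightMatrix_ne_zero ((hν v).trans_ne one_ne_zero)
  refine ⟨ν, ⟨fun v ↦ ?_, partner_adj⟩, funext fun ⟨e, he⟩ ↦ ?_⟩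
  · exact partner_unique (hν (ν v)) (by rw [weightMatrix_comm, hν])
  · have one_iff : f ⟨e, he⟩ = 1 ↔ matchingWeight G ν ⟨e, he⟩ = 1 := by
      rw [matchingWeight_eq_one_iff]
      constructor
      · induction e using Sym2.ind with
        | _ x y =>
          intro h
          rw [← weightMatrix_apply_of_adj f he] at h
          exact ⟨x, Sym2.congr_right.mpr (partner_unique h (hν x))⟩
      · rintro ⟨v, rfl⟩
        rw [← hν v, weightMatrix_apply_of_adj f (partner_adj v)]
    grind [matchingWeight_eq_zero_or_one (μ := ν) ⟨e, he⟩]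

theorem ncard_le_half_card {f : G.edgeSet → ℝ} (hf : G.IsFractionalMatching f) :
    ({e | f e = 1}.ncard : ℝ) ≤ (Fintype.card V : ℝ) / 2 :=
  (ncard_le_totalWeight fun e ↦ (hf.1 e).1).trans (totalWeight_le_half_card hf)

theorem IsMatchingInvolution.ncard_matchingWeight (hμ : IsMatchingInvolution G μ) :
    ({e | matchingWeight G μ e = 1}.ncard : ℝ) = (Fintype.card V : ℝ) / 2 := by
  have hperf := hμ.isFractionalPerfectMatching
  rw [(ncard_eq_totalWeight_iff fun e ↦ (hperf.1.1 e).1).mpr matchingWeight_eq_zero_or_one, hperf.2]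

theorem IsMatchingInvolution.mem_maxHalfIntegralMatchings (hμ : IsMatchingInvolution G μ) :
    matchingWeight G μ ∈ G.maxHalfIntegralMatchings := by
  have hperf := hμ.isFractionalPerfectMatching
  exact ⟨hperf.1, hperf.2.trans (fractionalMatchingNumber_eq_half_card hperf).symm,
    fun e ↦ (matchingWeight_eq_zero_or_one e).imp_right .inr⟩

theorem IsMatchingInvolution.isOptimalFractionalMatching_iff (hμ : IsMatchingInvolution G μ)
    {f : G.edgeSet → ℝ} :
    G.IsOptimalFractionalMatching f ↔ ∃ ν, IsMatchingInvolution G ν ∧ f = matchingWeight G ν := by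
  constructor
  · rintro ⟨⟨hf, hmax, -⟩, hopt⟩
    have hperf : G.IsFractionalPerfectMatching f :=
      ⟨hf, hmax.trans (fractionalMatchingNumber_eq_half_card hμ.isFractionalPerfectMatching)⟩
    refine exists_eq_matchingWeight hperf
      ((ncard_eq_totalWeight_iff fun e ↦ (hf.1 e).1).mp (le_antisymm ?_ ?_))
    · exact hperf.2 ▸ ncard_le_half_card hf
    · rw [hperf.2, ← hμ.ncard_matchingWeight]
      exact_mod_cast hopt _ hμ.mem_maxHalfIntegralMatchings
  · rintro ⟨ν, hν, rfl⟩
    refine ⟨hν.mem_maxHalfIntegralMatchings, fun g hg ↦ ?_⟩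
    have := (ncard_le_half_card hg.1).trans_eq hν.ncard_matchingWeight.symm
    exact_mod_cast this

end MatchingInvolutions

/-- The distinct cycles of `G` (as subgraphs) are pairwise edge-disjoint; a connected graph with
this property is a cactus. -/
def CyclesEdgeDisjoint {V : Type*} (G : SimpleGraph V) : Prop :=
  ∀ ⦃u v : V⦄ (c : G.Walk u u) (d : G.Walk v v), c.IsCycle → d.IsCycle →
    c.toSubgraph ≠ d.toSubgraph → ∀ e ∈ c.edges, e ∉ d.edges

section Cycles

open SimpleGraph

variable {V : Type*} {G : SimpleGraph V}

theorem cyclesEdgeDisjoint_of_cyclesVertexDisjoint (hG : G.CyclesVertexDisjoint) :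
    CyclesEdgeDisjoint G := by
  intro u v c d hc hd hne e he he'
  obtain ⟨x, y⟩ := e
  exact hG c d hc hd hne x (c.fst_mem_support_of_mem_edges he) (d.fst_mem_support_of_mem_edges he')

theorem CyclesEdgeDisjoint.toSubgraph_eq (hG : CyclesEdgeDisjoint G) {u v : V} {c : G.Walk u u}
    {d : G.Walk v v} (hc : c.IsCycle) (hd : d.IsCycle) {e : Sym2 V} (hec : e ∈ c.edges)
    (hed : e ∈ d.edges) : c.toSubgraph = d.toSubgraph :=
  of_not_not fun hne ↦ hG c d hc hd hne e hec hed

theorem CyclesEdgeDisjoint.mem_edges (hG : CyclesEdgeDisjoint G) {u v : V} {c : G.Walk u u}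
    {d : G.Walk v v} (hc : c.IsCycle) (hd : d.IsCycle) {e e' : Sym2 V} (hec : e ∈ c.edges)
    (hed : e ∈ d.edges) (he' : e' ∈ c.edges) : e' ∈ d.edges := by
  rwa [← d.mem_edges_toSubgraph, ← hG.toSubgraph_eq hc hd hec hed, c.mem_edges_toSubgraph]

theorem CyclesEdgeDisjoint.isChordless (hG : CyclesEdgeDisjoint G) {u : V} {c : G.Walk u u}
    (hc : c.IsCycle) : c.IsChordless := by
  classical
  rw [Walk.isChordless_iff_forall_mem_edges]
  intro x y hx hy hxy
  by_contra hchord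
  have rotate_edges {e} : e ∈ (c.rotate x hx).edges ↔ e ∈ c.edges :=
    (c.rotate_edges x hx).perm.mem_iff
  have hy' : y ∈ (c.rotate x hx).support := (c.mem_support_rotate_iff x hx).mpr hy
  set p := (c.rotate x hx).takeUntil y hy'
  have p_edges {e} (he : e ∈ p.edges) : e ∈ c.edges :=
    rotate_edges.mp ((c.rotate x hx).edges_takeUntil_subset_edges hy' he)
  have p_isPath : p.IsPath := (hc.rotate hx).isPath_takeUntil hy'
  have shortcut_isCycle : (p.cons hxy.symm).IsCycle :=
    (Walk.cons_isCycle_iff p hxy.symm).mpr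
      ⟨p_isPath, fun h ↦ hchord (Sym2.eq_swap (a := y) ▸ p_edges h)⟩
  have snd_mem : s(x, p.snd) ∈ p.edges :=
    Walk.mk_start_snd_mem_edges (Walk.not_nil_of_ne hxy.ne)
  refine hchord (hG.mem_edges shortcut_isCycle hc (List.mem_cons_of_mem _ snd_mem)
    (p_edges snd_mem) ?_)
  rw [Walk.edges_cons, Sym2.eq_swap]
  exact List.mem_cons_self

theorem exists_walk_getVert (f : ℕ → V) (n : ℕ) (h : ∀ i < n, G.Adj (f i) (f (i + 1))) :
    ∃ p : G.Walk (f 0) (f n), p.length = n ∧ ∀ i ≤ n, p.getVert i = f i := by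
  induction n generalizing f with
  | zero => exact ⟨.nil, rfl, fun i hi ↦ by rw [Nat.le_zero.mp hi, Walk.getVert_zero]⟩
  | succ n ih =>
    obtain ⟨p, hlen, hget⟩ := ih (f ∘ Nat.succ) fun i hi ↦ h (i + 1) (by lia)
    refine ⟨p.cons (h 0 n.succ_pos), by rw [Walk.length_cons, hlen], fun i hi ↦ ?_⟩
    cases i with
    | zero => rfl
    | succ i => exact hget i (by lia)

theorem exists_isCycle_getVert {f : ℕ → V} {n : ℕ} {v : V} (hn : 3 ≤ n)
    (hadj : ∀ i < n, G.Adj (f i) (f (i + 1))) (hinj : Set.InjOn f (Set.Iio n)) (hf₀ : f 0 = v)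
    (hf : f n = v) :
    ∃ c : G.Walk v v, c.IsCycle ∧ c.length = n ∧ ∀ i ≤ n, c.getVert i = f i := by
  have closed_walk := exists_walk_getVert f n hadj
  rw [hf₀, hf] at closed_walk
  obtain ⟨c, hlen, hget⟩ := closed_walk
  refine ⟨c, Walk.isCycle_iff_isPath_tail_and_le_length.mpr ⟨?_, by lia⟩, hlen, hget⟩
  have length_tail := c.length_tail_add_one (Walk.not_nil_iff_lt_length.mpr (by lia))
  rw [← Walk.IsPath.getVert_injOn_iff]
  intro i hi j hj hij
  simp only [Set.mem_ofPred_eq] at hi hj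
  rw [c.getVert_tail, c.getVert_tail, hget _ (by lia), hget _ (by lia)] at hij
  obtain hi' | hi' := Nat.lt_or_eq_of_le (show i + 1 ≤ n by lia) <;>
    obtain hj' | hj' := Nat.lt_or_eq_of_le (show j + 1 ≤ n by lia)
  · exact Nat.succ_injective (hinj hi' hj' hij)
  · rw [hj', hf, ← hf₀] at hij
    exact absurd (hinj hi' (show 0 < n by lia) hij) i.succ_ne_zero
  · rw [hi', hf, ← hf₀] at hij
    exact absurd (hinj (show 0 < n by lia) hj' hij) j.succ_ne_zero.symm
  · lia

theorem eq_of_toSubgraph_eq_of_snd_eq {u : V} {c d : G.Walk u u} (hc : c.IsCycle) (hd : d.IsCycle)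
    (h : c.toSubgraph = d.toSubgraph) (hsnd : c.snd = d.snd) : c = d := by
  wlog hle : c.length ≤ d.length generalizing c d
  · exact (this hd hc h.symm hsnd.symm (by lia)).symm
  have getVert_eq (i : ℕ) (hi : i + 1 ≤ c.length) :
      c.getVert i = d.getVert i ∧ c.getVert (i + 1) = d.getVert (i + 1) := by
    induction i with
    | zero => exact ⟨by rw [Walk.getVert_zero, Walk.getVert_zero], hsnd⟩
    | succ i ih =>
      obtain ⟨hi₀, hi₁⟩ := ih (by lia)
      refine ⟨hi₁, ?_⟩
      have neighbors_eq : c.toSubgraph.neighborSet (c.getVert (i + 1)) =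
          d.toSubgraph.neighborSet (d.getVert (i + 1)) := by rw [h, hi₁]
      rw [hc.neighborSet_toSubgraph_internal (Nat.add_one_ne_zero i) (by lia),
        hd.neighborSet_toSubgraph_internal (Nat.add_one_ne_zero i) (by lia)] at neighbors_eq
      simp only [Nat.add_sub_cancel, hi₀] at neighbors_eq
      exact Set.pair_eq_pair_iff.mp neighbors_eq |>.elim And.right
        fun hswap ↦ by rw [hswap.2, hswap.1]
  have length_eq : c.length = d.length := by
    have three_le := hc.three_le_length
    have getVert_length := (getVert_eq (c.length - 1) (by lia)).2
    rw [Nat.sub_add_cancel (by lia), c.getVert_length, eq_comm,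
      hd.getVert_endpoint_iff hle] at getVert_length
    lia
  refine Walk.ext_getVert_le_length length_eq fun i hi ↦ ?_
  cases i with
  | zero => rw [Walk.getVert_zero, Walk.getVert_zero]
  | succ i => exact (getVert_eq i hi).2

theorem eq_or_eq_reverse_of_toSubgraph_eq {u : V} {c d : G.Walk u u} (hc : c.IsCycle)
    (hd : d.IsCycle) (h : c.toSubgraph = d.toSubgraph) : d = c ∨ d = c.reverse := by
  have neighbors_eq : d.toSubgraph.neighborSet u = c.toSubgraph.neighborSet u := by rw [h]
  rw [hc.neighborSet_toSubgraph_endpoint, hd.neighborSet_toSubgraph_endpoint] at neighbors_eq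
  have snd_mem : d.snd ∈ ({c.snd, c.penultimate} : Set V) := neighbors_eq ▸ Set.mem_insert _ _
  refine snd_mem.imp (fun hsnd ↦ ?_) fun hsnd ↦ ?_
  · exact eq_of_toSubgraph_eq_of_snd_eq hd hc h.symm hsnd
  · exact eq_of_toSubgraph_eq_of_snd_eq hd hc.reverse (by rw [Walk.toSubgraph_reverse, h])
      (by rw [hsnd, Walk.snd_reverse])

end Cycles

/-- A permutation `σ` such that `v, μ (σ v), σ v` is a walk in `G` for every `v`; this walk consists
of an edge of `G` followed by an edge of the perfect matching `μ`, and it runs back and forth along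
the same matching edge when `σ v = v`. -/
def IsAlternatingPerm {V : Type*} (G : SimpleGraph V) (μ : V → V) (σ : Equiv.Perm V) : Prop :=
  ∀ v, G.Adj v (μ (σ v))

/-- The walk `v, μ (σ v), σ v, μ (σ² v), σ² v, …` which, for an alternating permutation `σ`, uses an
edge of `G` and an edge of the perfect matching `μ` in turn. -/
def alternatingOrbit {V : Type*} (μ : V → V) (σ : Equiv.Perm V) (v : V) (j : ℕ) : V :=
  if Even j then σ^[j / 2] v else μ (σ^[j / 2 + 1] v)

/-- The closed walk `c` is a cycle formed by one period of the alternating orbit of its base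
point. -/
structure TracesOrbit {V : Type*} {G : SimpleGraph V} (μ : V → V) (σ : Equiv.Perm V) {v : V}
    (c : G.Walk v v) : Prop where
  isCycle : c.IsCycle
  length_eq : c.length = 2 * Function.minimalPeriod σ v
  getVert_eq : ∀ j ≤ c.length, c.getVert j = alternatingOrbit μ σ v j

section AlternatingPermutations

open SimpleGraph Function

variable {V : Type*} {G : SimpleGraph V} {μ : V → V} {σ τ ρ : Equiv.Perm V} {v : V}

theorem alternatingOrbit_two_mul (i : ℕ) : alternatingOrbit μ σ v (2 * i) = σ^[i] v := by
  simp [alternatingOrbit]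

theorem alternatingOrbit_two_mul_add_one (i : ℕ) :
    alternatingOrbit μ σ v (2 * i + 1) = μ (σ^[i + 1] v) := by
  simp [alternatingOrbit, Nat.mul_add_div]

namespace IsAlternatingPerm

theorem adj_alternatingOrbit (hσ : IsAlternatingPerm G μ σ) (hμ : IsMatchingInvolution G μ)
    (j : ℕ) : G.Adj (alternatingOrbit μ σ v j) (alternatingOrbit μ σ v (j + 1)) := by
  obtain ⟨i, rfl | rfl⟩ := j.even_or_odd'
  · rw [alternatingOrbit_two_mul, alternatingOrbit_two_mul_add_one, iterate_succ_apply']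
    exact hσ _
  · rw [alternatingOrbit_two_mul_add_one, add_assoc, ← mul_add_one, alternatingOrbit_two_mul]
    exact (hμ.adj _).symm

theorem injOn_alternatingOrbit (hσ : IsAlternatingPerm G μ σ) (hG : G.IsBipartite)
    (hμ : IsMatchingInvolution G μ) :
    Set.InjOn (alternatingOrbit μ σ v) (Set.Iio (2 * minimalPeriod σ v)) := by
  obtain ⟨C⟩ := hG
  have color_iterate (i : ℕ) : C (σ^[i] v) = C v := by
    induction i with
    | zero => rfl
    | succ i ih =>
      rw [iterate_succ_apply']
      have := C.valid (hσ (σ^[i] v))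
      have := C.valid (hμ.adj (σ (σ^[i] v)))
      lia
  have color_partner (i : ℕ) : C (μ (σ^[i] v)) ≠ C v :=
    color_iterate i ▸ (C.valid (hμ.adj (σ^[i] v))).symm
  intro j hj k hk hjk
  simp only [Set.mem_Iio] at hj hk
  obtain ⟨i, rfl | rfl⟩ := j.even_or_odd' <;> obtain ⟨l, rfl | rfl⟩ := k.even_or_odd' <;>
    simp only [alternatingOrbit_two_mul, alternatingOrbit_two_mul_add_one] at hjk
  · rw [iterate_injOn_Iio_minimalPeriod (Set.mem_Iio.mpr (by lia)) (Set.mem_Iio.mpr (by lia)) hjk]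
  · exact absurd (hjk ▸ color_iterate i) (color_partner _)
  · exact absurd (hjk ▸ color_iterate l) (color_partner _)
  · rw [iterate_succ_apply', iterate_succ_apply'] at hjk
    rw [iterate_injOn_Iio_minimalPeriod (Set.mem_Iio.mpr (by lia)) (Set.mem_Iio.mpr (by lia))
      (σ.injective (hμ.involutive.injective hjk))]

theorem exists_tracesOrbit [Finite V] (hσ : IsAlternatingPerm G μ σ) (hG : G.IsBipartite)
    (hμ : IsMatchingInvolution G μ) (hv : σ v ≠ v) : ∃ c : G.Walk v v, TracesOrbit μ σ c := by
  have period_pos : 0 < minimalPeriod σ v :=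
    minimalPeriod_pos_of_mem_periodicPts (σ.injective.mem_periodicPts v)
  have period_ne_one : minimalPeriod σ v ≠ 1 := mt minimalPeriod_eq_one_iff_isFixedPt.mp hv
  obtain ⟨c, hc, hlen, hget⟩ := exists_isCycle_getVert (G := G) (v := v)
    (show 3 ≤ 2 * minimalPeriod σ v by lia) (fun j _ ↦ hσ.adj_alternatingOrbit hμ j)
    (hσ.injOn_alternatingOrbit hG hμ) (alternatingOrbit_two_mul 0)
    (by rw [alternatingOrbit_two_mul, iterate_minimalPeriod])
  exact ⟨c, hc, hlen, hlen ▸ hget⟩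

end IsAlternatingPerm

namespace TracesOrbit

variable {c : G.Walk v v}

theorem minimalPeriod_pos (h : TracesOrbit μ σ c) : 0 < minimalPeriod σ v := by
  have := h.isCycle.three_le_length
  have := h.length_eq
  lia

theorem getVert_even (h : TracesOrbit μ σ c) {i : ℕ} (hi : i ≤ minimalPeriod σ v) :
    c.getVert (2 * i) = σ^[i] v := by
  rw [h.getVert_eq _ (by rw [h.length_eq]; lia), alternatingOrbit_two_mul]

theorem getVert_odd (h : TracesOrbit μ σ c) {i : ℕ} (hi : i < minimalPeriod σ v) :
    c.getVert (2 * i + 1) = μ (σ^[i + 1] v) := by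
  rw [h.getVert_eq _ (by rw [h.length_eq]; lia), alternatingOrbit_two_mul_add_one]

theorem snd_eq (h : TracesOrbit μ σ c) : c.snd = μ (σ v) :=
  h.getVert_odd h.minimalPeriod_pos

theorem penultimate_eq (h : TracesOrbit μ σ c) : c.penultimate = μ v := by
  have period_pos := h.minimalPeriod_pos
  have := h.getVert_odd (i := minimalPeriod σ v - 1) (by lia)
  rw [Nat.sub_add_cancel period_pos, iterate_minimalPeriod] at this
  rw [← this, Walk.penultimate, h.length_eq]
  congr 1
  lia

theorem mem_edges (h : TracesOrbit μ σ c) : s(v, μ v) ∈ c.edges := by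
  rw [Sym2.eq_swap, ← h.penultimate_eq]
  exact c.mk_penultimate_end_mem_edges h.isCycle.not_nil

theorem apply_mem_support (h : TracesOrbit μ σ c) (hμ : Involutive μ) {x : V}
    (hx : x ∈ c.support) : μ x ∈ c.support := by
  obtain ⟨j, rfl, hj⟩ := Walk.mem_support_iff_exists_getVert.mp hx
  rw [h.length_eq] at hj
  obtain ⟨i, rfl | rfl⟩ := j.even_or_odd'
  · cases i with
    | zero =>
      rw [mul_zero, Walk.getVert_zero, ← h.penultimate_eq]
      exact c.getVert_mem_support _
    | succ i =>
      rw [h.getVert_even (by lia), ← h.getVert_odd (by lia)]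
      exact c.getVert_mem_support _
  · rw [h.getVert_odd (by lia), hμ, ← h.getVert_even (by lia)]
    exact c.getVert_mem_support _

end TracesOrbit

theorem IsAlternatingPerm.apply_eq_apply [Finite V] (hσ : IsAlternatingPerm G μ σ)
    (hτ : IsAlternatingPerm G μ τ) (hG : G.IsBipartite) (hcyc : CyclesEdgeDisjoint G)
    (hμ : IsMatchingInvolution G μ) (hσv : σ v ≠ v) (hτv : τ v ≠ v) : σ v = τ v := by
  obtain ⟨c, hc⟩ := hσ.exists_tracesOrbit hG hμ hσv
  obtain ⟨d, hd⟩ := hτ.exists_tracesOrbit hG hμ hτv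
  have neighbors_eq : c.toSubgraph.neighborSet v = d.toSubgraph.neighborSet v := by
    rw [hcyc.toSubgraph_eq hc.isCycle hd.isCycle hc.mem_edges hd.mem_edges]
  rw [hc.isCycle.neighborSet_toSubgraph_endpoint, hd.isCycle.neighborSet_toSubgraph_endpoint,
    hc.snd_eq, hd.snd_eq, hc.penultimate_eq, hd.penultimate_eq] at neighbors_eq
  apply hμ.involutive.injective
  exact Set.pair_eq_pair_iff.mp neighbors_eq |>.elim And.left
    fun hswap ↦ hswap.1.trans hswap.2

/-- An alternating permutation that agrees with every other one on the vertices which that one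
moves. -/
structure IsMaximalAlternatingPerm {V : Type*} (G : SimpleGraph V) (μ : V → V)
    (ρ : Equiv.Perm V) : Prop where
  isAlternatingPerm : IsAlternatingPerm G μ ρ
  apply_eq : ∀ σ, IsAlternatingPerm G μ σ → ∀ v, σ v = v ∨ σ v = ρ v

theorem exists_isMaximalAlternatingPerm [Finite V] (hG : G.IsBipartite)
    (hcyc : CyclesEdgeDisjoint G) (hμ : IsMatchingInvolution G μ) :
    ∃ ρ, IsMaximalAlternatingPerm G μ ρ := by
  obtain ⟨ρ, hρ, hρ'⟩ := exists_perm_of_agree_on_moved (S := {σ | IsAlternatingPerm G μ σ})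
    fun σ hσ τ hτ v ↦ hσ.apply_eq_apply hτ hG hcyc hμ
  refine ⟨ρ, fun v ↦ ?_, hρ⟩
  obtain hv | ⟨σ, hσ, hv⟩ := hρ' v
  · exact hv.symm ▸ hμ.adj v
  · exact hv.symm ▸ hσ v

theorem exists_isMatchingInvolution_apply_ne (hμ : IsMatchingInvolution G μ) {u : V}
    {c : G.Walk u u} (hc : c.IsCycle) (hμc : ∀ x ∈ c.support, s(x, μ x) ∈ c.edges) :
    ∃ ν, IsMatchingInvolution G ν ∧ ∀ x ∈ c.support, ν x ≠ μ x := by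
  have other_neighbor (x : V) (hx : x ∈ c.support) :
      ∃ w, w ≠ μ x ∧ ∀ y, s(x, y) ∈ c.edges ↔ y = μ x ∨ y = w := by
    obtain ⟨y, z, hyz, hN⟩ := Set.ncard_eq_two.mp (hc.ncard_neighborSet_toSubgraph_eq_two hx)
    have mem_edges_iff (w : V) : s(x, w) ∈ c.edges ↔ w = y ∨ w = z := by
      rw [← Walk.adj_toSubgraph_iff_mem_edges, ← Subgraph.mem_neighborSet, hN,
        Set.mem_insert_iff, Set.mem_singleton_iff]
    obtain rfl | rfl := (mem_edges_iff _).mp (hμc x hx)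
    · exact ⟨z, hyz.symm, mem_edges_iff⟩
    · exact ⟨y, hyz, fun w ↦ (mem_edges_iff w).trans or_comm⟩
  choose! τ τ_ne mem_edges_iff using other_neighbor
  have τ_mem_edges {x : V} (hx : x ∈ c.support) : s(x, τ x) ∈ c.edges :=
    (mem_edges_iff x hx _).mpr (.inr rfl)
  have τ_mem_support {x : V} (hx : x ∈ c.support) : τ x ∈ c.support :=
    c.snd_mem_support_of_mem_edges (τ_mem_edges hx)
  have τ_τ {x : V} (hx : x ∈ c.support) : τ (τ x) = x := by
    have := (mem_edges_iff _ (τ_mem_support hx) x).mp (Sym2.eq_swap ▸ τ_mem_edges hx)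
    exact (this.resolve_left fun h ↦ τ_ne x hx (hμ.involutive.eq_iff.mp h.symm)).symm
  have μ_notMem_support {x : V} (hx : x ∉ c.support) : μ x ∉ c.support := fun h ↦
    hx (hμ.involutive x ▸ c.snd_mem_support_of_mem_edges (hμc _ h))
  classical
  -- The new matching is the symmetric difference of `μ` and `c`.
  refine ⟨fun x ↦ if x ∈ c.support then τ x else μ x, ⟨fun x ↦ ?_, fun x ↦ ?_⟩, fun x hx ↦ ?_⟩
  · by_cases hx : x ∈ c.support
    · simp only [hx, if_true, τ_mem_support hx, τ_τ hx]
    · simp only [hx, if_false, μ_notMem_support hx, hμ.involutive x]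
  · by_cases hx : x ∈ c.support
    · simpa only [hx, if_true] using c.adj_of_mem_edges (τ_mem_edges hx)
    · simpa only [hx, if_false] using hμ.adj x
  · simpa only [hx, if_true] using τ_ne x hx

theorem exists_isAlternatingPerm_apply_ne (hμ : IsMatchingInvolution G μ) {u : V}
    {c : G.Walk u u} (hc : c.IsCycle) (hμc : ∀ x ∈ c.support, s(x, μ x) ∈ c.edges) :
    ∃ σ, IsAlternatingPerm G μ σ ∧ σ u ≠ u := by
  obtain ⟨ν, hν, hne⟩ := exists_isMatchingInvolution_apply_ne hμ hc hμc
  refine ⟨hν.involutive.toPerm.trans hμ.involutive.toPerm, fun v ↦ ?_, fun hu ↦ ?_⟩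
  · simpa [hμ.involutive (ν v)] using hν.adj v
  · exact hne u c.start_mem_support (hμ.involutive.eq_iff.mp hu)

theorem IsMaximalAlternatingPerm.exists_tracesOrbit [Finite V]
    (hρ : IsMaximalAlternatingPerm G μ ρ) (hG : G.IsBipartite) (hcyc : CyclesEdgeDisjoint G)
    (hμ : IsMatchingInvolution G μ) {u : V} {c : G.Walk u u} (hc : c.IsCycle)
    (hμc : ∀ x ∈ c.support, μ x ∈ c.support) :
    ρ u ≠ u ∧ ∃ d, TracesOrbit μ ρ d ∧ (d = c ∨ d = c.reverse) := by
  have matching_mem_edges (x : V) (hx : x ∈ c.support) : s(x, μ x) ∈ c.edges :=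
    (hcyc.isChordless hc).mem_edges hx (hμc x hx) (hμ.adj x)
  obtain ⟨σ, hσ, hσu⟩ := exists_isAlternatingPerm_apply_ne hμ hc matching_mem_edges
  have hρu : ρ u ≠ u := (hρ.apply_eq σ hσ u).resolve_left hσu ▸ hσu
  obtain ⟨d, hd⟩ := hρ.isAlternatingPerm.exists_tracesOrbit hG hμ hρu
  exact ⟨hρu, d, hd, eq_or_eq_reverse_of_toSubgraph_eq hc hd.isCycle <|
    hcyc.toSubgraph_eq hc hd.isCycle (matching_mem_edges u c.start_mem_support) hd.mem_edges⟩

end AlternatingPermutations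

namespace MixedGraph

open SimpleGraph Function Matrix

variable {V : Type*} (M : MixedGraph V)

theorem hermitianAdjMatrix_eq_zero {u v : V} (h : ¬ M.graph.Adj u v) :
    M.hermitianAdjMatrix u v = 0 := by
  have huv : ¬ M.Arc u v := mt (M.adj_of_arc u v) h
  have hvu : ¬ M.Arc v u := fun hvu ↦ h (M.adj_of_arc v u hvu).symm
  simp only [hermitianAdjMatrix, of_apply, huv, hvu, h, if_false]

theorem hermitianAdjMatrix_mul_swap {u v : V} (h : M.graph.Adj u v) :
    M.hermitianAdjMatrix u v * M.hermitianAdjMatrix v u = 1 := by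
  by_cases huv : M.Arc u v
  · simp [hermitianAdjMatrix, huv, M.not_arc_of_arc u v huv]
  · by_cases hvu : M.Arc v u <;> simp [hermitianAdjMatrix, huv, hvu, h, h.symm]

theorem adj_of_hermitianAdjMatrix_ne_zero {u v : V} (h : M.hermitianAdjMatrix u v ≠ 0) :
    M.graph.Adj u v :=
  of_not_not (mt M.hermitianAdjMatrix_eq_zero h)

theorem hermitianAdjMatrix_ne_zero {u v : V} (h : M.graph.Adj u v) :
    M.hermitianAdjMatrix u v ≠ 0 :=
  left_ne_zero_of_mul_eq_one (M.hermitianAdjMatrix_mul_swap h)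

open Classical in
theorem hermitianAdjMatrix_eq_I_zpow {u v : V} (h : M.graph.Adj u v) :
    M.hermitianAdjMatrix u v =
      Complex.I ^ ((if M.Arc u v then 1 else 0) - (if M.Arc v u then 1 else 0) : ℤ) := by
  by_cases huv : M.Arc u v
  · simp [hermitianAdjMatrix, huv, M.not_arc_of_arc u v huv]
  · by_cases hvu : M.Arc v u <;> simp [hermitianAdjMatrix, huv, hvu, h]

/-- The product of the entries of the Hermitian adjacency matrix along a walk. -/
noncomputable def walkWeight {u v : V} (p : M.graph.Walk u v) : ℂ :=
  (p.darts.map fun d ↦ M.hermitianAdjMatrix d.fst d.snd).prod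

open Classical in
theorem walkWeight_eq_I_zpow {u v : V} (p : M.graph.Walk u v) :
    M.walkWeight p = Complex.I ^ ((p.darts.countP fun d ↦ M.Arc d.fst d.snd : ℤ) -
      (p.darts.countP fun d ↦ M.Arc d.snd d.fst : ℤ)) := by
  unfold walkWeight
  induction p.darts with
  | nil => simp
  | cons d l ih =>
    rw [List.map_cons, List.prod_cons, ih, M.hermitianAdjMatrix_eq_I_zpow d.adj,
      ← zpow_add₀ Complex.I_ne_zero, List.countP_cons, List.countP_cons]
    congr 1
    push_cast [decide_eq_true_eq]
    ring

theorem signature_modEq_length_iff {u : V} {c : M.graph.Walk u u} (hc : Even c.length) :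
    M.signature c ≡ c.length [MOD 4] ↔ M.walkWeight c = Complex.I ^ c.length := by
  rw [walkWeight_eq_I_zpow, signature]
  generalize (_ - _ : ℤ) = z
  -- Since the length is even, `z` is congruent to it modulo `4` if and only if `-z` is.
  have natAbs_modEq_iff : z.natAbs ≡ c.length [MOD 4] ↔ ((4 : ℕ) : ℤ) ∣ z - c.length := by
    obtain ⟨k, hk⟩ := hc
    unfold Nat.ModEq
    lia
  rw [natAbs_modEq_iff, ← Complex.isPrimitiveRoot_I.zpow_eq_one_iff_dvd,
    zpow_sub₀ Complex.I_ne_zero, div_eq_one_iff_eq (zpow_ne_zero _ Complex.I_ne_zero),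
    zpow_natCast]

theorem signature_reverse {u : V} (c : M.graph.Walk u u) :
    M.signature c.reverse = M.signature c := by
  simp only [signature, Walk.darts_reverse, List.countP_reverse, List.countP_map]
  rw [← Int.natAbs_neg, neg_sub]
  rfl

theorem walkWeight_eq_prod_range {u v : V} (p : M.graph.Walk u v) :
    M.walkWeight p =
      ∏ i ∈ Finset.range p.length, M.hermitianAdjMatrix (p.getVert i) (p.getVert (i + 1)) := by
  induction p with
  | nil => rfl
  | cons h p ih =>
    rw [Walk.length_cons, Finset.prod_range_succ']
    simp only [Walk.getVert_cons_succ, Walk.getVert_zero]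
    rw [← ih, walkWeight, Walk.darts_cons, List.map_cons, List.prod_cons, mul_comm]
    rfl

/-- The matrix `A` with `A v w = H v (μ w) * H (μ w) w`, where `H` is the Hermitian adjacency
matrix. It arises from `H` by permuting the columns along the perfect matching `μ` and rescaling
them so that the diagonal entries become `1`. -/
noncomputable def matchedMatrix (μ : V → V) : Matrix V V ℂ :=
  of fun v w ↦ M.hermitianAdjMatrix v (μ w) * M.hermitianAdjMatrix (μ w) w

variable {M} {μ : V → V}

theorem matchedMatrix_apply_self (hμ : IsMatchingInvolution M.graph μ) (v : V) :
    M.matchedMatrix μ v v = 1 :=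
  M.hermitianAdjMatrix_mul_swap (hμ.adj v)

theorem adj_of_matchedMatrix_ne_zero {v w : V} (h : M.matchedMatrix μ v w ≠ 0) :
    M.graph.Adj v (μ w) :=
  M.adj_of_hermitianAdjMatrix_ne_zero (left_ne_zero_of_mul h)

theorem walkWeight_eq_prod_matchedMatrix {ρ : Equiv.Perm V} {v : V} {c : M.graph.Walk v v}
    (hc : TracesOrbit μ ρ c) :
    M.walkWeight c =
      ∏ i ∈ Finset.range (minimalPeriod ρ v), M.matchedMatrix μ (ρ^[i] v) (ρ^[i + 1] v) := by
  have prod_pairs (g : ℕ → ℂ) (n : ℕ) :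
      ∏ i ∈ Finset.range (2 * n), g i = ∏ i ∈ Finset.range n, g (2 * i) * g (2 * i + 1) := by
    induction n with
    | zero => rfl
    | succ n ih =>
      rw [mul_add_one, Finset.prod_range_succ, Finset.prod_range_succ, ih, Finset.prod_range_succ,
        mul_assoc]
  rw [walkWeight_eq_prod_range, hc.length_eq, prod_pairs]
  refine Finset.prod_congr rfl fun i hi ↦ ?_
  rw [Finset.mem_range] at hi
  rw [hc.getVert_even hi.le, hc.getVert_odd hi, add_assoc, ← mul_add_one,
    hc.getVert_even (i := i + 1) hi]
  rfl

theorem signature_modEq_length_iff_prod {ρ : Equiv.Perm V} {v : V} {c : M.graph.Walk v v}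
    (hc : TracesOrbit μ ρ c) :
    M.signature c ≡ c.length [MOD 4] ↔ ∏ i ∈ Finset.range (minimalPeriod ρ v),
      -M.matchedMatrix μ (ρ^[i] v) (ρ^[i + 1] v) = 1 := by
  rw [M.signature_modEq_length_iff (hc.length_eq ▸ even_two_mul _),
    walkWeight_eq_prod_matchedMatrix hc, Finset.prod_neg, Finset.card_range, hc.length_eq, pow_mul,
    Complex.I_sq]
  obtain h | h := neg_one_pow_eq_or ℂ (minimalPeriod ρ v) <;> rw [h]
  · rw [one_mul]
  · rw [neg_one_mul, neg_eq_iff_eq_neg]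

variable [Fintype V] [DecidableEq V]

theorem det_matchedMatrix (hμ : Involutive μ) :
    (M.matchedMatrix μ).det =
      hμ.toPerm.sign * M.hermitianAdjMatrix.det * ∏ v, M.hermitianAdjMatrix (μ v) v := by
  have : M.matchedMatrix μ = M.hermitianAdjMatrix.submatrix id hμ.toPerm *
      diagonal fun v ↦ M.hermitianAdjMatrix (μ v) v := by
    ext v w
    rw [mul_diagonal]
    rfl
  rw [this, det_mul, det_permute', det_diagonal]

theorem nonsingular_iff_det_matchedMatrix_ne_zero (hμ : IsMatchingInvolution M.graph μ) :
    M.Nonsingular ↔ (M.matchedMatrix μ).det ≠ 0 := by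
  rw [det_matchedMatrix hμ.involutive, Nonsingular]
  have := Finset.prod_ne_zero_iff.mpr fun v (_ : v ∈ Finset.univ) ↦
    M.hermitianAdjMatrix_ne_zero (hμ.adj v).symm
  simp [this]

theorem det_matchedMatrix_eq_zero_iff {ρ : Equiv.Perm V} (hμ : IsMatchingInvolution M.graph μ)
    (hρ : IsMaximalAlternatingPerm M.graph μ ρ) :
    (M.matchedMatrix μ).det = 0 ↔ ∃ v, ρ v ≠ v ∧ ∏ i ∈ Finset.range (minimalPeriod ρ v),
      -M.matchedMatrix μ (ρ^[i] v) (ρ^[i + 1] v) = 1 :=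
  det_eq_zero_iff_of_subordinate (matchedMatrix_apply_self hμ) fun σ hσ ↦
    hρ.apply_eq σ fun v ↦ adj_of_matchedMatrix_ne_zero (hσ v)

theorem nonsingular_iff (hbip : M.graph.IsBipartite) (hcyc : CyclesEdgeDisjoint M.graph)
    (hμ : IsMatchingInvolution M.graph μ) :
    M.Nonsingular ↔ ∀ (u : V) (c : M.graph.Walk u u), c.IsCycle → Even c.length →
      M.signature c ≡ c.length [MOD 4] → ∃ v ∈ c.support, μ v ∉ c.support := by
  obtain ⟨ρ, hρ⟩ := exists_isMaximalAlternatingPerm hbip hcyc hμ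
  rw [nonsingular_iff_det_matchedMatrix_ne_zero hμ, ne_eq, det_matchedMatrix_eq_zero_iff hμ hρ,
    not_exists]
  constructor
  · intro hprod u c hc _ hsig
    by_contra! hμc
    obtain ⟨hu, d, hd, hdc⟩ := hρ.exists_tracesOrbit hbip hcyc hμ hc hμc
    refine hprod u ⟨hu, (signature_modEq_length_iff_prod hd).mp ?_⟩
    obtain rfl | rfl := hdc
    · exact hsig
    · rwa [signature_reverse, Walk.length_reverse]
  · rintro hleave v ⟨hv, hprod⟩
    obtain ⟨c, hc⟩ := hρ.isAlternatingPerm.exists_tracesOrbit hbip hμ hv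
    obtain ⟨x, hx, hμx⟩ := hleave v c hc.isCycle (hc.length_eq ▸ even_two_mul _)
      ((signature_modEq_length_iff_prod hc).mpr hprod)
    exact hμx (hc.apply_mem_support hμ.involutive hx)

theorem Nonsingular.exists_perm_adj (h : M.Nonsingular) :
    ∃ π : Equiv.Perm V, ∀ v, M.graph.Adj v (π v) := by
  contrapose! h
  rw [Nonsingular, not_not, ← det_transpose, det_apply]
  refine Finset.sum_eq_zero fun π _ ↦ ?_
  obtain ⟨v, hv⟩ := h π
  have prod_eq_zero : ∏ w, M.hermitianAdjMatrix w (π w) = 0 :=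
    Finset.prod_eq_zero (Finset.mem_univ v) (M.hermitianAdjMatrix_eq_zero hv)
  simp only [transpose_apply, prod_eq_zero, smul_zero]

end MixedGraph

theorem theorem1p5_general {V : Type*} [Fintype V] [DecidableEq V] (M : MixedGraph V)
    (hbip : M.graph.IsBipartite) (hcyc : CyclesEdgeDisjoint M.graph) :
    M.Nonsingular ↔
      (∃ f : M.graph.edgeSet → ℝ, M.graph.IsFractionalPerfectMatching f) ∧
      (∃ f : M.graph.edgeSet → ℝ, M.graph.IsOptimalFractionalMatching f ∧
        ∀ (u : V) (c : M.graph.Walk u u), c.IsCycle → Even c.length →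
          M.signature c ≡ c.length [MOD 4] →
            ∃ e ∈ M.graph.edgesLeaving {x | x ∈ c.support}, f e = 1) := by
  constructor
  · intro hM
    obtain ⟨π, hπ⟩ := hM.exists_perm_adj
    obtain ⟨μ, hμ⟩ := exists_isMatchingInvolution_of_perm hbip hπ
    refine ⟨⟨matchingWeight M.graph μ, hμ.isFractionalPerfectMatching⟩, matchingWeight M.graph μ,
      hμ.isOptimalFractionalMatching_iff.mpr ⟨μ, hμ, rfl⟩, fun u c hc heven hsig ↦ ?_⟩
    rw [exists_mem_edgesLeaving_matchingWeight_eq_one_iff hμ]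
    exact (MixedGraph.nonsingular_iff hbip hcyc hμ).mp hM u c hc heven hsig
  · rintro ⟨⟨g, hg⟩, f, hf, hleave⟩
    obtain ⟨π, hπ⟩ := exists_perm_adj_of_isFractionalPerfectMatching hg
    obtain ⟨ν, hν⟩ := exists_isMatchingInvolution_of_perm hbip hπ
    obtain ⟨μ, hμ, rfl⟩ := hν.isOptimalFractionalMatching_iff.mp hf
    simp only [exists_mem_edgesLeaving_matchingWeight_eq_one_iff hμ, Set.mem_ofPred_eq] at hleave
    exact (MixedGraph.nonsingular_iff hbip hcyc hμ).mpr hleave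

theorem theorem1p5 {V : Type*} [Fintype V] [DecidableEq V] (M : MixedGraph V)
    (hbip : M.graph.IsBipartite) (hdisj : M.graph.CyclesVertexDisjoint) :
    M.Nonsingular ↔
      (∃ f : M.graph.edgeSet → ℝ, M.graph.IsFractionalPerfectMatching f) ∧
      (∃ f : M.graph.edgeSet → ℝ, M.graph.IsOptimalFractionalMatching f ∧
        ∀ (u : V) (c : M.graph.Walk u u), c.IsCycle → Even c.length →
          M.signature c ≡ c.length [MOD 4] →
            ∃ e ∈ M.graph.edgesLeaving {x | x ∈ c.support}, f e = 1) :=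
  theorem1p5_general M hbip (cyclesEdgeDisjoint_of_cyclesVertexDisjoint hdisj)
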